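/- For a metrizable space $Z$, let $P(Z)$ be the set of bounded continuous pseudometrics $d:Z\times Z\to[0,\infty)$, with the metric induced by the sup-norm $\|d\|=\sup_{z,w\in Z}|d(z,w)|$ (so $\|d\|=0$ if $Z=\emptyset$), and let $A(Z)\subset P(Z)$ be the subspace of bounded admissible metrics, i.e. of those metrics that induce the topology of $Z$. Let $Pc(Z)$ be the set of all $d\in A(Z)$ for which there is a compact set $K\subset Z$ such that $d(x,y)=\|d\|$ implies $x,y\in K$, and let $Pp(Z)$ be the set of all $d\in A(Z)$ for which there is exactly one set $\{z,w\}\subset Z$ (with $z=w$ allowed) such that $d(z,w)=\|d\|$. Let $M$ denote either $Pc$ or $Pp$ (the same choice for all spaces). Theorem. Let $X$ and $Y$ be metrizable spaces that are both nonempty or both empty. The following are equivalent: 1. $X$ and $Y$ are homeomorphic; 2. there is a surjective isometry $T:P(X)\to P(Y)$ with $T(M(X))=M(Y)$; 3. there is a surjective isometry $T:A(X)\to A(Y)$ with $T(M(X))=M(Y)$; 4. there is a surjective isometry $T:M(X)\to M(Y)$. Moreover, for each surjective isometry $T:P(X)\to P(Y)$ with $T(M(X))=M(Y)$ there is a homeomorphism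 $\varphi:Y\to X$ such that $T(d)(x,y)=d(\varphi(x),\varphi(y))$ for all $d\in P(X)$ and all $x,y\in Y$. If neither $X$ nor $Y$ has exactly two points, this homeomorphism $\varphi$ is unique. -/

import Mathlib

open Topology TopologicalSpace
open scoped BoundedContinuousFunction

namespace MetricSpaces

/-- `P(Z)`: the bounded continuous pseudometrics on `Z`, as a subset of the space of bounded
continuous real-valued functions on `Z × Z` with the sup-norm. As a subtype it carries the
sup-metric. -/
def pseudo (Z : Type*) [TopologicalSpace Z] : Set (Z × Z →ᵇ ℝ) :=
  {d | (∀ x y, 0 ≤ d (x, y)) ∧ (∀ x, d (x, x) = 0) ∧ (∀ x y, d (x, y) = d (y, x)) ∧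
    ∀ x y z, d (x, z) ≤ d (x, y) + d (y, z)}

/-- `A(Z)`: the bounded continuous admissible metrics on `Z`, that is, the elements of `P(Z)`
that separate points and whose open balls generate the given topology of `Z`. -/
def adm (Z : Type*) [TopologicalSpace Z] : Set (Z × Z →ᵇ ℝ) :=
  {d | d ∈ pseudo Z ∧ (∀ x y, d (x, y) = 0 → x = y) ∧
    ∀ U : Set Z, IsOpen U ↔ ∀ x ∈ U, ∃ ε > 0, {y | d (x, y) < ε} ⊆ U}

/-- `Pc(Z)`: the admissible metrics `d` for which some compact set contains all points `x, y`
with `d (x, y) = ‖d‖`. -/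
def Pc (Z : Type*) [TopologicalSpace Z] : Set (Z × Z →ᵇ ℝ) :=
  {d | d ∈ adm Z ∧ ∃ K : Set Z, IsCompact K ∧ ∀ x y, d (x, y) = ‖d‖ → x ∈ K ∧ y ∈ K}

/-- `Pp(Z)`: the admissible metrics `d` for which there is exactly one set `{z, w}` with
`d (z, w) = ‖d‖`. -/
def Pp (Z : Type*) [TopologicalSpace Z] : Set (Z × Z →ᵇ ℝ) :=
  {d | d ∈ adm Z ∧ ∃ z w, d (z, w) = ‖d‖ ∧
    ∀ x y, d (x, y) = ‖d‖ → ({x, y} : Set Z) = {z, w}}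

/-- The two possible meanings of `M`. -/
inductive PeakKind where
  | compact
  | point

/-- `M(Z)`: either `Pc(Z)` or `Pp(Z)`. -/
def metr (k : PeakKind) (Z : Type*) [TopologicalSpace Z] : Set (Z × Z →ᵇ ℝ) :=
  match k with
  | .compact => Pc Z
  | .point => Pp Z

/-- For sets `A`, `B` of functions with subsets of interest `M`, `N`, the map `T : A → B`
carries `A ∩ M` onto `B ∩ N`. -/
def CarriesOnto {E F : Type*} {A : Set E} {B : Set F} (T : A → B) (M : Set E) (N : Set F) :
    Prop :=
  T '' {a | (a : E) ∈ M} = {b | (b : F) ∈ N}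

end MetricSpaces

/-!
A surjective isometry `T : P(X) → P(Y)` is shown to be composition with a homeomorphism; this gives
the implication from isometry to homeomorphism once an isometry between `M(X)` and `M(Y)` has been
extended to the closures `P(X)` and `P(Y)` (`pseudo_subset_closure_Pp`,
`nonempty_isometryEquiv_of_dense`). The converse implications come from pulling back metrics.

First, `T 0 = 0`, because `0` is the only `e` with `‖d - d'‖ ≤ max ‖d - e‖ ‖d' - e‖` for all `d, d'`
(`isometry_zero`). So `T` preserves norms.

The second step recovers point evaluations. If `f` and `g` attain their norms along the same
ultrafilter `V` of `X × X`, then `‖f + g‖ = ‖f‖ + ‖g‖`, so that `‖(f + g) - f‖ = ‖f + g‖ - ‖f‖`, and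
a point where `T (f + g)` is almost maximal is also one where `T f` is. The images of all functions
peaking along `V` therefore peak along a common ultrafilter `U` of `Y × Y`, and `T d` has a limit
along `U` which is at least that of `d` along `V`: for `c = lim d > 0` and large `t`, the function
`f = t • min d c` peaks along `V` and has `‖f - d‖ = ‖f‖ - c` (`exists_ultrafilter_transport`).
Going from a point `(z, w)` to `Y × Y` and back, and using a pseudometric with a strict peak at `{z, w}`
(`exists_strict_peak`), these inequalities become equalities: `d (z, w)` is the limit of `T d` along
some ultrafilter (`exists_ultrafilter_eval`). Applied to the inverse of `T`, this transfers the
estimate `|d - d (z, w)| ≤ ε + C * (‖p‖ - p)`, valid for a strict peak `p`, to `Y × Y`. Hence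
`T d (u n, v n)` tends to `d (z, w)` for all `d` along any maximizing sequence of `T p`
(`exists_seq_tendsto_eval`).

Such a sequence subconverges in `Y × Y`: otherwise a function that separates the even from the odd
terms of a sparse subsequence yields a pseudometric oscillating along it
(`exists_pseudo_not_tendsto`). So each pair of distinct points of `X` corresponds to a pair in `Y`
(`exists_eval_eq`), and conversely. The triangle inequality forces this bijection of edges to
preserve triangles, hence to come from a bijection of points (`exists_vertex_map`), which is a
homeomorphism since the pseudometrics determine the topology (`exists_homeomorph_of_isometry`).
-/

namespace MetricSpaces

open Filter

/-! ### Operations on bounded pseudometrics -/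

section Constructions

variable {X : Type*} [TopologicalSpace X]

theorem le_norm_apply (d : X × X →ᵇ ℝ) (q : X × X) : d q ≤ ‖d‖ :=
  (le_abs_self _).trans (d.norm_coe_le_norm q)

theorem norm_le_of_pseudo {d : X × X →ᵇ ℝ} (hd : d ∈ pseudo X) {C : ℝ} (hC : 0 ≤ C)
    (h : ∀ x y, d (x, y) ≤ C) : ‖d‖ ≤ C := by
  rw [BoundedContinuousFunction.norm_le hC]
  rintro ⟨x, y⟩
  rw [Real.norm_eq_abs, abs_of_nonneg (hd.1 x y)]
  exact h x y

theorem exists_norm_sub_lt [Nonempty X] {d : X × X →ᵇ ℝ} (hd : d ∈ pseudo X) {ε : ℝ}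
    (hε : 0 < ε) : ∃ x y, ‖d‖ - ε < d (x, y) := by
  by_contra! h
  obtain ⟨x⟩ := ‹Nonempty X›
  have h0 : 0 ≤ ‖d‖ - ε := (hd.1 x x).trans (h x x)
  linarith [norm_le_of_pseudo hd h0 h]

theorem zero_mem_pseudo : (0 : X × X →ᵇ ℝ) ∈ pseudo X := by
  refine ⟨?_, ?_, ?_, ?_⟩ <;> intros <;> simp

theorem add_mem_pseudo {d e : X × X →ᵇ ℝ} (hd : d ∈ pseudo X) (he : e ∈ pseudo X) :
    d + e ∈ pseudo X := by
  refine ⟨fun x y => ?_, fun x => ?_, fun x y => ?_, fun x y z => ?_⟩ <;>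
    simp only [BoundedContinuousFunction.add_apply]
  · linarith [hd.1 x y, he.1 x y]
  · linarith [hd.2.1 x, he.2.1 x]
  · linarith [hd.2.2.1 x y, he.2.2.1 x y]
  · linarith [hd.2.2.2 x y z, he.2.2.2 x y z]

theorem smul_mem_pseudo {d : X × X →ᵇ ℝ} (hd : d ∈ pseudo X) {t : ℝ} (ht : 0 ≤ t) :
    t • d ∈ pseudo X := by
  refine ⟨fun x y => ?_, fun x => ?_, fun x y => ?_, fun x y z => ?_⟩ <;>
    simp only [BoundedContinuousFunction.smul_apply, smul_eq_mul]
  · exact mul_nonneg ht (hd.1 x y)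
  · rw [hd.2.1 x, mul_zero]
  · rw [hd.2.2.1 x y]
  · rw [← mul_add]
    exact mul_le_mul_of_nonneg_left (hd.2.2.2 x y z) ht

theorem inf_const_apply (d : X × X →ᵇ ℝ) (c : ℝ) (q : X × X) :
    (d ⊓ BoundedContinuousFunction.const (X × X) c) q = min (d q) c :=
  rfl

theorem inf_const_mem_pseudo {d : X × X →ᵇ ℝ} (hd : d ∈ pseudo X) {c : ℝ} (hc : 0 ≤ c) :
    d ⊓ BoundedContinuousFunction.const (X × X) c ∈ pseudo X := by
  refine ⟨fun x y => ?_, fun x => ?_, fun x y => ?_, fun x y z => ?_⟩ <;>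
    simp only [inf_const_apply]
  · exact le_min (hd.1 x y) hc
  · rw [hd.2.1 x, min_eq_left hc]
  · rw [hd.2.2.1 x y]
  · have := hd.2.2.2 x y z
    have := hd.1 x y
    have := hd.1 y z
    rcases le_total (d (x, y)) c with h1 | h1 <;> rcases le_total (d (y, z)) c with h2 | h2 <;>
      simp only [h1, h2, min_eq_left, min_eq_right] <;>
      first
        | exact (min_le_left _ _).trans (by linarith)
        | exact (min_le_right _ _).trans (by linarith)

/-- A bounded continuous function `h` induces the pseudometric `|h x - h y|`. -/
theorem exists_pseudo_abs_sub {h : X → ℝ} (hc : Continuous h) {B : ℝ} (hB : ∀ x, |h x| ≤ B) :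
    ∃ d ∈ pseudo X, ∀ x y, d (x, y) = |h x - h y| := by
  refine ⟨BoundedContinuousFunction.ofNormedAddCommGroup (fun q : X × X => |h q.1 - h q.2|)
    (by fun_prop) (B + B) ?_, ⟨?_, ?_, ?_, ?_⟩, ?_⟩
  · intro q
    rw [Real.norm_eq_abs, abs_abs]
    exact (abs_sub _ _).trans (add_le_add (hB _) (hB _))
  · intro x y
    simp
  · intro x
    simp
  · intro x y
    simp [abs_sub_comm]
  · intro x y z
    simpa using abs_sub_le (h x) (h y) (h z)
  · intro x y
    simp

end Constructions

/-! ### Separating and peaking pseudometrics -/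

section Metrizable

variable {X : Type*} [TopologicalSpace X] [MetrizableSpace X]

/-- Disjoint closed sets are separated by a pseudometric collapsing the second of them. -/
theorem exists_pseudo_separating {A B : Set X} (hA : IsClosed A) (hB : IsClosed B)
    (hAB : Disjoint A B) : ∃ d ∈ pseudo X, (∀ x ∈ A, ∀ y ∈ B, d (x, y) = 1) ∧
      ∀ x ∈ B, ∀ y ∈ B, d (x, y) = 0 := by
  let := metrizableSpaceMetric X
  obtain ⟨f, h0, h1, h01⟩ := exists_continuous_zero_one_of_isClosed hA hB hAB
  obtain ⟨d, hd, hf⟩ := exists_pseudo_abs_sub f.continuous (B := 1) (fun x => by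
    rw [abs_of_nonneg (h01 x).1]; exact (h01 x).2)
  refine ⟨d, hd, fun x hx y hy => ?_, fun x hx y hy => ?_⟩
  · rw [hf, h0 hx, h1 hy]; simp
  · rw [hf, h1 hx, h1 hy]; simp

/-- For a point `x` and a finite set `S` some pseudometric gives distance one from `x` to the other
points of `S` and collapses the latter. -/
theorem exists_pseudo_indicator (x : X) {S : Set X} (hS : S.Finite) :
    ∃ d ∈ pseudo X, ∀ p : Sym2 X, ¬ p.IsDiag → (∀ y ∈ p, y ∈ S) →
      ∀ a b, p = s(a, b) → (x ∈ p → d (a, b) = 1) ∧ (x ∉ p → d (a, b) = 0) := by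
  obtain ⟨d, hd, h1, h0⟩ := exists_pseudo_separating (A := {x}) (B := S \ {x})
    isClosed_singleton (hS.subset Set.sdiff_subset).isClosed
    (Set.disjoint_left.2 fun y hy hy' => hy'.2 hy)
  refine ⟨d, hd, ?_⟩
  rintro p hp hpS a b rfl
  have hab : a ≠ b := by simpa using hp
  have ha := hpS a (by simp)
  have hb := hpS b (by simp)
  refine ⟨fun hx => ?_, fun hx => ?_⟩
  · rcases Sym2.mem_iff.1 hx with rfl | rfl
    · exact h1 _ rfl _ ⟨hb, hab.symm⟩
    · rw [hd.2.2.1]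
      exact h1 _ rfl _ ⟨ha, hab⟩
  · rw [Sym2.mem_iff, not_or] at hx
    exact h0 _ ⟨ha, Ne.symm hx.1⟩ _ ⟨hb, Ne.symm hx.2⟩

/-- The pseudometrics distinguish unordered pairs of distinct points. -/
theorem sym2_eq_of_forall_pseudo {z w u v : X} (hzw : z ≠ w)
    (h : ∀ d ∈ pseudo X, d (z, w) = d (u, v)) : s(z, w) = s(u, v) := by
  have huv : u ≠ v := by
    rintro rfl
    obtain ⟨d, hd, h1, -⟩ := exists_pseudo_separating (A := {z}) (B := {w}) isClosed_singleton
      isClosed_singleton (by simpa using hzw)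
    have := h d hd
    rw [h1 z rfl w rfl, hd.2.1] at this
    exact one_ne_zero this
  have key : ∀ x, x ∈ s(z, w) → x ∈ s(u, v) := by
    intro x hx
    obtain ⟨d, hd, hi⟩ := exists_pseudo_indicator x (S := {z, w, u, v}) (by simp)
    by_contra hx'
    have e1 := (hi s(z, w) (by simpa using hzw) (by simp) z w rfl).1 hx
    have e2 := (hi s(u, v) (by simpa using huv) (by simp) u v rfl).2 hx'
    rw [h d hd, e2] at e1
    exact zero_ne_one e1
  have hz := Sym2.mem_iff.1 (key z (by simp))
  have hw := Sym2.mem_iff.1 (key w (by simp))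
  rw [Sym2.eq_iff]
  grind

/-- A pseudometric with a strict peak at `{z, w}`: near-maximal values are only taken near `(z, w)`
or `(w, z)`, so the defect `‖p‖ - p` controls the oscillation of every other pseudometric. -/
theorem exists_strict_peak {z w : X} (hzw : z ≠ w) :
    ∃ p ∈ pseudo X, 0 < ‖p‖ ∧ p (z, w) = ‖p‖ ∧ (∀ x y, p (x, y) = ‖p‖ → s(x, y) = s(z, w)) ∧
      ∀ d ∈ pseudo X, ∀ ε > 0, ∃ C ≥ 0, ∀ x y,
        |d (x, y) - d (z, w)| ≤ ε + C * (‖p‖ - p (x, y)) := by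
  let := metrizableSpaceMetric X
  set r := dist z w with hr
  have hr0 : 0 < r := dist_pos.2 hzw
  -- `-r ≤ f ≤ r`, with the extreme values attained only at `w` and `z`, and nearly only near them
  set f : X → ℝ := fun x => min (dist x w) r - min (dist x z) r with hf
  have hfz : f z = r := by simp [hf, hr]
  have hfw : f w = -r := by simp [hf, hr, dist_comm w z]
  have hlo : ∀ x, -r + min (dist x w) r ≤ f x := fun x => by
    have := min_le_right (dist x z) r
    simp only [hf]; linarith
  have hhi : ∀ x, f x ≤ r - min (dist x z) r := fun x => by
    have := min_le_right (dist x w) r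
    simp only [hf]; linarith
  have hmin : ∀ x y : X, 0 ≤ min (dist x y) r := fun x y => le_min dist_nonneg hr0.le
  obtain ⟨p, hp, hpf⟩ := exists_pseudo_abs_sub (h := f) (by fun_prop) (B := r) (fun x => by
    rw [abs_le]
    constructor <;> linarith [hlo x, hhi x, hmin x z, hmin x w])
  have hpzw : p (z, w) = 2 * r := by
    rw [hpf, hfz, hfw, abs_of_nonneg] <;> linarith
  have hnorm : ‖p‖ = 2 * r := by
    refine le_antisymm (norm_le_of_pseudo hp (by linarith) fun x y => ?_) (hpzw ▸ le_norm_apply p _)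
    rw [hpf, abs_le]
    constructor <;> linarith [hlo x, hhi x, hmin x z, hmin x w, hlo y, hhi y, hmin y z, hmin y w]
  have hnear : ∀ x y δ, δ ≤ r → 2 * r - δ < f x - f y → dist x z < δ ∧ dist y w < δ := by
    intro x y δ hδ h
    have h1 : min (dist x z) r < δ := by linarith [hhi x, hlo y, hmin y w]
    have h2 : min (dist y w) r < δ := by linarith [hhi x, hlo y, hmin x z]
    exact ⟨(min_lt_iff.1 h1).resolve_right hδ.not_gt, (min_lt_iff.1 h2).resolve_right hδ.not_gt⟩
  refine ⟨p, hp, by linarith, by rw [hpzw, hnorm], fun x y hxy => ?_, fun d hd ε hε => ?_⟩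
  · rw [hnorm, hpf] at hxy
    have heq : ∀ x y, f x - f y = 2 * r → x = z ∧ y = w := fun x y h => by
      have h1 : min (dist x z) r = 0 := by linarith [hhi x, hlo y, hmin y w, hmin x z]
      have h2 : min (dist y w) r = 0 := by linarith [hhi x, hlo y, hmin x z, hmin y w]
      constructor
      · rcases min_choice (dist x z) r with h | h
        · exact dist_eq_zero.1 (h ▸ h1)
        · linarith
      · rcases min_choice (dist y w) r with h | h
        · exact dist_eq_zero.1 (h ▸ h2)
        · linarith
    rcases abs_choice (f x - f y) with h | h
    · obtain ⟨rfl, rfl⟩ := heq x y (h ▸ hxy)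
      rfl
    · obtain ⟨rfl, rfl⟩ := heq y x (by linarith)
      exact Sym2.eq_swap
  · obtain ⟨δ, hδ, hcont⟩ :=
      Metric.continuousAt_iff.1 (d.continuous.continuousAt (x := (z, w))) ε hε
    have hmr : 0 < min δ r := lt_min hδ hr0
    refine ⟨‖d‖ / min δ r, by positivity, fun x y => ?_⟩
    rw [hnorm]
    have hple : 0 ≤ 2 * r - p (x, y) := by linarith [le_norm_apply p (x, y)]
    by_cases hbig : 2 * r - min δ r < p (x, y)
    · have hgood : ∀ x y, 2 * r - min δ r < f x - f y → |d (x, y) - d (z, w)| < ε := by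
        intro x y h
        obtain ⟨h1, h2⟩ := hnear x y _ (min_le_right _ _) h
        have := @hcont (x, y) (by
          rw [Prod.dist_eq]
          exact max_lt (h1.trans_le (min_le_left _ _)) (h2.trans_le (min_le_left _ _)))
        rwa [Real.dist_eq] at this
      have hlt : |d (x, y) - d (z, w)| < ε := by
        rw [hpf] at hbig
        rcases abs_choice (f x - f y) with h | h
        · exact hgood x y (h ▸ hbig)
        · rw [hd.2.2.1 x y]
          exact hgood y x (by linarith)
      have : 0 ≤ ‖d‖ / min δ r * (2 * r - p (x, y)) := by positivity
      linarith
    · have h1 : min δ r ≤ 2 * r - p (x, y) := by linarith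
      have h2 : ‖d‖ ≤ ‖d‖ / min δ r * (2 * r - p (x, y)) := by
        calc ‖d‖ = ‖d‖ / min δ r * min δ r := by field_simp
          _ ≤ _ := by gcongr
      have h3 : |d (x, y) - d (z, w)| ≤ ‖d‖ := by
        rw [abs_le]
        constructor <;>
          linarith [hd.1 x y, hd.1 z w, le_norm_apply d (x, y), le_norm_apply d (z, w)]
      linarith

end Metrizable

/-! ### Isometries and limits along ultrafilters -/

section Isometry

variable {X Y : Type*} [TopologicalSpace X] [TopologicalSpace Y]

/-- Values of pseudometrics along an ultrafilter converge, since they are bounded. -/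
theorem exists_tendsto_ultrafilter (d : X × X →ᵇ ℝ) (U : Ultrafilter (X × X)) :
    ∃ c, Tendsto d U (𝓝 c) := by
  have h : (U.map d : Filter ℝ) ≤ 𝓟 (Set.Icc (-‖d‖) ‖d‖) := by
    rw [le_principal_iff, Ultrafilter.coe_map, mem_map]
    refine univ_mem' fun q => ?_
    exact abs_le.1 (d.norm_coe_le_norm q)
  obtain ⟨c, -, hc⟩ := isCompact_Icc.ultrafilter_le_nhds _ h
  exact ⟨c, hc⟩

/-- Zero is the only `e` satisfying `‖d - d'‖ ≤ max ‖d - e‖ ‖d' - e‖` for all `d` and `d'`. -/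
theorem isometry_zero (T : pseudo X ≃ᵢ pseudo Y) (d : pseudo X) (hd : d.1 = 0) :
    (T d).1 = 0 := by
  have h1 : ∀ e : pseudo X, dist e d = ‖e.1‖ := fun e => by
    rw [Subtype.dist_eq, hd, dist_zero_right]
  have h2 : ∀ e e' : pseudo X, dist e e' ≤ max ‖e.1‖ ‖e'.1‖ := fun e e' => by
    rw [Subtype.dist_eq, BoundedContinuousFunction.dist_le (by positivity)]
    rintro ⟨x, y⟩
    rw [Real.dist_eq, abs_le]
    have := le_norm_apply e.1 (x, y)
    have := le_norm_apply e'.1 (x, y)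
    have := e.2.1 x y
    have := e'.2.1 x y
    have := le_max_left ‖e.1‖ ‖e'.1‖
    have := le_max_right ‖e.1‖ ‖e'.1‖
    constructor <;> linarith
  have h3 : ∀ e e' : pseudo Y, dist e e' ≤ max (dist e (T d)) (dist e' (T d)) := fun e e' => by
    have := h2 (T.symm e) (T.symm e')
    rwa [← h1, ← h1, T.symm.dist_eq, ← T.dist_eq, ← T.dist_eq, T.apply_symm_apply,
      T.apply_symm_apply] at this
  -- test `T d` against the pair `0`, `2 • T d`, for which it is the midpoint
  have h4 := h3 ⟨0, zero_mem_pseudo⟩ ⟨(2 : ℝ) • (T d).1, smul_mem_pseudo (T d).2 (by norm_num)⟩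
  simp only [Subtype.dist_eq] at h4
  have h5 : dist ((2 : ℝ) • (T d).1) (T d).1 = ‖(T d).1‖ := by
    rw [dist_eq_norm, two_smul, add_sub_cancel_right]
  rw [h5, dist_zero_left, dist_zero_left, max_self, norm_smul, Real.norm_ofNat] at h4
  exact norm_le_zero_iff.1 (by linarith)

theorem norm_isometry (T : pseudo X ≃ᵢ pseudo Y) (d : pseudo X) : ‖(T d).1‖ = ‖d.1‖ := by
  have h := T.dist_eq d ⟨0, zero_mem_pseudo⟩
  rwa [Subtype.dist_eq, Subtype.dist_eq, isometry_zero T ⟨0, zero_mem_pseudo⟩ rfl,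
    dist_zero_right, dist_zero_right] at h

theorem isometry_sub_le (T : pseudo X ≃ᵢ pseudo Y) (d e : pseudo X) (q : Y × Y) :
    (T d).1 q - (T e).1 q ≤ ‖d.1 - e.1‖ := by
  rw [← dist_eq_norm, ← Subtype.dist_eq, ← T.dist_eq, Subtype.dist_eq]
  exact (le_abs_self _).trans
    (BoundedContinuousFunction.dist_coe_le_dist (f := (T d).1) (g := (T e).1) q)

/-- If `f` and `g` attain their norms along the same filter, then so does `f + g`, and norms add. -/
theorem norm_add_of_tendsto {f g : X × X →ᵇ ℝ} {V : Filter (X × X)} [V.NeBot]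
    (hf : Tendsto f V (𝓝 ‖f‖)) (hg : Tendsto g V (𝓝 ‖g‖)) : ‖f + g‖ = ‖f‖ + ‖g‖ :=
  le_antisymm (norm_add_le _ _)
    (le_of_tendsto (hf.add hg) (Eventually.of_forall fun q => le_norm_apply (f + g) q))

/-- The functions attaining their norm along an ultrafilter `V` of `X × X` form a convex cone on
which the norm is additive. Hence their images under `T` are simultaneously almost maximal, and
this produces an ultrafilter of `Y × Y`. Comparing `d` with the multiples of `min d c`, where `c` is
the limit of `d` along `V`, bounds `T d` from below along it. -/
theorem exists_ultrafilter_transport [Nonempty Y] (T : pseudo X ≃ᵢ pseudo Y)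
    (V : Ultrafilter (X × X)) :
    ∃ U : Ultrafilter (Y × Y),
      (∀ f : pseudo X, Tendsto f.1 V (𝓝 ‖f.1‖) → Tendsto (T f).1 U (𝓝 ‖f.1‖)) ∧
      ∀ (d : pseudo X) (c c' : ℝ), Tendsto d.1 V (𝓝 c) → Tendsto (T d).1 U (𝓝 c') → c ≤ c' := by
  -- `S (f, ε)` is the set where `T f` is within `ε` of its norm
  let ι := {f : pseudo X // Tendsto f.1 V (𝓝 ‖f.1‖)} × {ε : ℝ // 0 < ε}
  let S : ι → Set (Y × Y) := fun i => {q | ‖i.1.1.1‖ - i.2.1 < (T i.1.1).1 q}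
  have hne : ∀ i, (S i).Nonempty := fun i => by
    obtain ⟨x, y, h⟩ := exists_norm_sub_lt (T i.1.1).2 i.2.2
    rw [norm_isometry] at h
    exact ⟨(x, y), h⟩
  have hzero : Tendsto (0 : X × X →ᵇ ℝ) V (𝓝 ‖(0 : X × X →ᵇ ℝ)‖) := by
    rw [norm_zero]
    exact tendsto_const_nhds
  have : Nonempty ι := ⟨⟨⟨⟨0, zero_mem_pseudo⟩, hzero⟩, ⟨1, one_pos⟩⟩⟩
  have hdir : Directed (· ≥ ·) fun i => 𝓟 (S i) := by
    rintro ⟨⟨f, hf⟩, ⟨ε, hε⟩⟩ ⟨⟨g, hg⟩, ⟨δ, hδ⟩⟩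
    have hadd := norm_add_of_tendsto hf hg
    refine ⟨⟨⟨⟨f.1 + g.1, add_mem_pseudo f.2 g.2⟩, ?_⟩, ⟨min ε δ, lt_min hε hδ⟩⟩, ?_, ?_⟩
    · rw [hadd]
      exact hf.add hg
    · refine principal_mono.2 fun q hq => ?_
      have h1 := isometry_sub_le T ⟨f.1 + g.1, add_mem_pseudo f.2 g.2⟩ f q
      simp only [S, Set.mem_ofPred_eq, add_sub_cancel_left, hadd] at h1 hq ⊢
      linarith [min_le_left ε δ]
    · refine principal_mono.2 fun q hq => ?_
      have h1 := isometry_sub_le T ⟨f.1 + g.1, add_mem_pseudo f.2 g.2⟩ g q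
      simp only [S, Set.mem_ofPred_eq, add_sub_cancel_right, hadd] at h1 hq ⊢
      linarith [min_le_right ε δ]
  have hbot : (⨅ i, 𝓟 (S i)).NeBot :=
    iInf_neBot_of_directed hdir fun i => principal_neBot_iff.2 (hne i)
  obtain ⟨U, hU⟩ := @Ultrafilter.exists_le _ _ hbot
  have hlim : ∀ f : pseudo X, Tendsto f.1 V (𝓝 ‖f.1‖) → Tendsto (T f).1 U (𝓝 ‖f.1‖) := by
    intro f hf
    refine tendsto_order.2 ⟨fun a ha => ?_, fun a ha => ?_⟩
    · have : S (⟨f, hf⟩, ⟨‖f.1‖ - a, sub_pos.2 ha⟩) ∈ (U : Filter (Y × Y)) :=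
        hU (mem_iInf_of_mem _ (mem_principal_self _))
      filter_upwards [this] with q hq
      simpa [S] using hq
    · refine Eventually.of_forall fun q => ?_
      have := le_norm_apply (T f).1 q
      rw [norm_isometry] at this
      exact this.trans_lt ha
  refine ⟨U, hlim, fun d c c' hd hc' => ?_⟩
  rcases le_or_gt c 0 with hc | hc
  · exact hc.trans (ge_of_tendsto hc' (Eventually.of_forall fun q => (T d).2.1 q.1 q.2))
  -- `f = t • min d c` attains its norm `t * c` along `V`, and `‖f - d‖ ≤ (t - 1) * c`
  set t : ℝ := 1 + ‖d.1‖ / c with ht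
  have ht1 : 1 ≤ t := by
    have : 0 ≤ ‖d.1‖ / c := by positivity
    linarith
  have htc : (t - 1) * c = ‖d.1‖ := by
    rw [ht]
    field_simp
    ring
  have hm := inf_const_mem_pseudo d.2 hc.le
  set m : X × X →ᵇ ℝ := d.1 ⊓ BoundedContinuousFunction.const (X × X) c with hmdef
  let f : pseudo X := ⟨t • m, smul_mem_pseudo hm (by linarith)⟩
  have hft : Tendsto f.1 V (𝓝 (t * c)) := by
    have h := (hd.min (tendsto_const_nhds (x := c))).const_mul t
    rwa [min_self] at h
  have hfle : ‖f.1‖ ≤ t * c := norm_le_of_pseudo f.2 (by positivity) fun x y =>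
    mul_le_mul_of_nonneg_left (min_le_right _ _) (by linarith)
  have hfn : ‖f.1‖ = t * c :=
    le_antisymm hfle (le_of_tendsto hft (Eventually.of_forall fun q => le_norm_apply f.1 q))
  have hfd : ‖f.1 - d.1‖ ≤ (t - 1) * c := by
    rw [BoundedContinuousFunction.norm_le (by rw [htc]; positivity)]
    rintro ⟨x, y⟩
    have h1 : (f.1 - d.1) (x, y) = t * min (d.1 (x, y)) c - d.1 (x, y) := rfl
    have h2 := d.2.1 x y
    have h3 := le_norm_apply d.1 (x, y)
    have h4 : 0 ≤ t * min (d.1 (x, y)) c := mul_nonneg (by linarith) (le_min h2 hc.le)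
    rw [Real.norm_eq_abs, h1, abs_le]
    refine ⟨by linarith, ?_⟩
    rcases le_total (d.1 (x, y)) c with h | h
    · rw [min_eq_left h]
      nlinarith
    · rw [min_eq_right h]
      linarith
  have hTf := hlim f (by rwa [hfn])
  rw [hfn] at hTf
  have hlow : t * c - (t - 1) * c ≤ c' :=
    le_of_tendsto_of_tendsto (hTf.sub_const ((t - 1) * c)) hc' (Eventually.of_forall fun q => by
      have := isometry_sub_le T f d q
      simp only
      linarith)
  linarith

/-- Evaluation at a pair of points of `X` becomes, through `T`, the limit along an ultrafilter
of `Y × Y`. -/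
theorem exists_ultrafilter_eval [MetrizableSpace X] [Nonempty Y] (T : pseudo X ≃ᵢ pseudo Y)
    (z w : X) :
    ∃ U : Ultrafilter (Y × Y), ∀ d : pseudo X, Tendsto (T d).1 U (𝓝 (d.1 (z, w))) := by
  have hX : Nonempty X := ⟨z⟩
  rcases eq_or_ne z w with rfl | hzw
  · obtain ⟨y⟩ := ‹Nonempty Y›
    refine ⟨pure (y, y), fun d => ?_⟩
    rw [d.2.2.1, ← (T d).2.2.1 y]
    exact tendsto_pure_nhds _ _
  obtain ⟨U, hU1, hU2⟩ := exists_ultrafilter_transport T (pure (z, w))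
  obtain ⟨V, hV1, hV2⟩ := exists_ultrafilter_transport T.symm U
  have hpure : ∀ d : X × X →ᵇ ℝ, Tendsto d (pure (z, w) : Ultrafilter (X × X)) (𝓝 (d (z, w))) :=
    fun d => tendsto_pure_nhds _ _
  obtain ⟨p, hp, -, hpzw, -, hpeak⟩ := exists_strict_peak hzw
  have hpV : Tendsto p V (𝓝 ‖p‖) := by
    have h := hU1 ⟨p, hp⟩ (hpzw ▸ hpure p)
    have h' := hV1 (T ⟨p, hp⟩) (by rwa [norm_isometry])
    rwa [T.symm_apply_apply, norm_isometry] at h'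
  refine ⟨U, fun d => ?_⟩
  obtain ⟨c, hc⟩ := exists_tendsto_ultrafilter (T d).1 U
  obtain ⟨b, hb⟩ := exists_tendsto_ultrafilter d.1 V
  have h1 : d.1 (z, w) ≤ c := hU2 d _ _ (hpure d.1) hc
  have h2 : c ≤ b := hV2 (T d) _ _ hc (by rwa [T.symm_apply_apply])
  -- the ultrafilter `V` obtained from the round trip converges to the peak of `p`
  have h3 : b ≤ d.1 (z, w) := by
    refine le_of_forall_pos_le_add fun ε hε => ?_
    obtain ⟨C, -, hC⟩ := hpeak d.1 d.2 ε hε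
    have h4 : Tendsto (fun q => d.1 (z, w) + (ε + C * (‖p‖ - p q))) V
        (𝓝 (d.1 (z, w) + (ε + C * (‖p‖ - ‖p‖)))) :=
      ((((hpV.const_sub _).const_mul _).const_add _).const_add _)
    rw [sub_self, mul_zero, add_zero] at h4
    refine le_of_tendsto_of_tendsto hb h4 (Eventually.of_forall fun q => ?_)
    have := (abs_le.1 (hC q.1 q.2)).2
    simp only
    linarith
  rwa [le_antisymm h1 (h2.trans h3)]

/-- A strict peak `p` at `{z, w}` is carried to a function `T p` whose maximizing sequences compute
the evaluation at `(z, w)`. -/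
theorem exists_seq_tendsto_eval [MetrizableSpace X] [MetrizableSpace Y] [Nonempty Y]
    (T : pseudo X ≃ᵢ pseudo Y) {z w : X} (hzw : z ≠ w) :
    ∃ u v : ℕ → Y, ∀ d : pseudo X,
      Tendsto (fun n => (T d).1 (u n, v n)) atTop (𝓝 (d.1 (z, w))) := by
  have hX : Nonempty X := ⟨z⟩
  obtain ⟨p, hp, -, -, -, hpeak⟩ := exists_strict_peak hzw
  set q := T ⟨p, hp⟩ with hq
  have hqn : ‖q.1‖ = ‖p‖ := norm_isometry T _
  choose u v huv using fun n : ℕ =>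
    exists_norm_sub_lt q.2 (Nat.one_div_pos_of_nat (n := n) (α := ℝ))
  have hlim : Tendsto (fun n => q.1 (u n, v n)) atTop (𝓝 ‖p‖) := by
    rw [← hqn]
    refine tendsto_of_tendsto_of_tendsto_of_le_of_le ?_ tendsto_const_nhds
      (fun n => (huv n).le) (fun n => le_norm_apply _ _)
    simpa using (tendsto_one_div_add_atTop_nhds_zero_nat (𝕜 := ℝ)).const_sub ‖q.1‖
  refine ⟨u, v, fun d => ?_⟩
  rw [Metric.tendsto_atTop']
  intro ε hε
  obtain ⟨C, hC0, hC⟩ := hpeak d.1 d.2 (ε / 2) (half_pos hε)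
  -- the estimate for `p` passes to `Y × Y` along the ultrafilters representing its points
  have hbound : ∀ a b : Y, |(T d).1 (a, b) - d.1 (z, w)| ≤ ε / 2 + C * (‖p‖ - q.1 (a, b)) := by
    intro a b
    obtain ⟨V, hV⟩ := exists_ultrafilter_eval T.symm a b
    have h1 := hV (T d)
    have h2 := hV q
    rw [T.symm_apply_apply] at h1
    rw [hq, T.symm_apply_apply] at h2
    exact le_of_tendsto_of_tendsto (h1.sub_const _).abs
      (((h2.const_sub _).const_mul _).const_add _) (Eventually.of_forall fun x => hC x.1 x.2)
  have h0 : Tendsto (fun n => ε / 2 + C * (‖p‖ - q.1 (u n, v n))) atTop (𝓝 (ε / 2)) := by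
    simpa using ((hlim.const_sub ‖p‖).const_mul C).const_add (ε / 2)
  obtain ⟨N, hN⟩ := eventually_atTop.1 (h0.eventually_lt_const (half_lt_self hε))
  exact ⟨N, fun n hn => (hbound _ _).trans_lt (hN n hn.le)⟩

end Isometry

/-! ### Convergence of evaluating sequences -/

section Sequences

variable {Y : Type*} [TopologicalSpace Y]

theorem eventually_ne_of_not_mapClusterPt {s : ℕ → Y} {y : Y} (h : ¬ MapClusterPt y atTop s) :
    ∀ᶠ n in atTop, s n ≠ y := by
  rw [mapClusterPt_iff_frequently] at h
  push Not at h
  obtain ⟨O, hO, hev⟩ := h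
  filter_upwards [hev] with n hn hy
  exact hn (hy ▸ mem_of_mem_nhds hO)

theorem mem_range_or_mapClusterPt [T1Space Y] {s : ℕ → Y} {y : Y}
    (hy : y ∈ closure (Set.range s)) : y ∈ Set.range s ∨ MapClusterPt y atTop s := by
  by_contra! h
  obtain ⟨h1, h2⟩ := h
  rw [mapClusterPt_iff_frequently] at h2
  push Not at h2
  obtain ⟨O, hO, hev⟩ := h2
  obtain ⟨N, hN⟩ := eventually_atTop.1 hev
  have hsub : Set.range s ⊆ s '' Set.Iio N ∪ (interior O)ᶜ := by
    rintro _ ⟨n, rfl⟩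
    rcases lt_or_ge n N with hn | hn
    · exact Or.inl ⟨n, hn, rfl⟩
    · exact Or.inr fun h => hN n hn (interior_subset h)
  have hcl : IsClosed (s '' Set.Iio N ∪ (interior O)ᶜ) :=
    ((Set.finite_Iio N).image s).isClosed.union isOpen_interior.isClosed_compl
  rcases closure_minimal hsub hcl hy with ⟨n, -, hn⟩ | h
  · exact h1 ⟨n, hn⟩
  · exact h (mem_interior_iff_mem_nhds.2 hO)

variable [MetrizableSpace Y]

/-- If `u` does not accumulate anywhere and `v` does not
accumulate at the terms of `u`, then along a sparse subsequence the terms of even index of `u` can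
be separated from all other terms of `u` and `v`, which makes some pseudometric oscillate along
`(u n, v n)`. -/
theorem exists_pseudo_not_tendsto {u v : ℕ → Y} (huv : ∀ n, u n ≠ v n)
    (hu : ∀ y, ¬ MapClusterPt y atTop u) (hv : ∀ n, ¬ MapClusterPt (u n) atTop v) :
    ∃ d ∈ pseudo Y, ∀ l, ¬ Tendsto (fun n => d (u n, v n)) atTop (𝓝 l) := by
  -- a subsequence `f` with `u (f i) ≠ u (f j)` for `i ≠ j` and `u (f i) ≠ v (f j)` for all `i`, `j`
  obtain ⟨f, -, hf⟩ := exists_seq_of_forall_finset_exists (fun _ : ℕ => True)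
    (fun m n => m < n ∧ u n ≠ u m ∧ u n ≠ v m ∧ v n ≠ u m) (fun s _ => by
      have : ∀ᶠ n in atTop, ∀ m ∈ s, m < n ∧ u n ≠ u m ∧ u n ≠ v m ∧ v n ≠ u m := by
        rw [eventually_all_finset]
        intro m _
        exact (eventually_gt_atTop m).and ((eventually_ne_of_not_mapClusterPt (hu _)).and
          ((eventually_ne_of_not_mapClusterPt (hu _)).and
            (eventually_ne_of_not_mapClusterPt (hv m))))
      obtain ⟨n, hn⟩ := this.exists
      exact ⟨n, trivial, hn⟩)
  have hmono : StrictMono f := fun m n hmn => (hf m n hmn).1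
  have hinj : ∀ i j, u (f i) = u (f j) → i = j := fun i j h => by
    rcases lt_trichotomy i j with hij | hij | hij
    · exact ((hf i j hij).2.1 h.symm).elim
    · exact hij
    · exact ((hf j i hij).2.1 h).elim
  have hne : ∀ i j, u (f i) ≠ v (f j) := fun i j h => by
    rcases lt_trichotomy i j with hij | hij | hij
    · exact (hf i j hij).2.2.2 h.symm
    · exact huv _ (hij ▸ h)
    · exact (hf j i hij).2.2.1 h
  have heven : StrictMono fun i : ℕ => f (2 * i) := fun i j h => hmono (by lia)
  have hodd : StrictMono fun i : ℕ => f (2 * i + 1) := fun i j h => hmono (by lia)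
  have hA : IsClosed (Set.range fun i => u (f (2 * i))) := by
    refine isClosed_of_closure_subset fun y hy => ?_
    exact (mem_range_or_mapClusterPt hy).resolve_right fun h =>
      hu y (h.of_comp (u := u) heven.tendsto_atTop)
  have hAB : Disjoint (Set.range fun i => u (f (2 * i)))
      (closure ((Set.range fun i => u (f (2 * i + 1))) ∪ Set.range fun i => v (f i))) := by
    rw [Set.disjoint_left]
    rintro _ ⟨i, rfl⟩ h
    rw [closure_union] at h
    rcases h with h | h
    · rcases mem_range_or_mapClusterPt h with ⟨j, hj⟩ | h
      · have := hinj _ _ hj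
        lia
      · exact hu _ (h.of_comp (u := u) hodd.tendsto_atTop)
    · rcases mem_range_or_mapClusterPt h with ⟨j, hj⟩ | h
      · exact hne _ _ hj.symm
      · exact hv _ (h.of_comp (u := v) hmono.tendsto_atTop)
  obtain ⟨d, hd, h1, h0⟩ := exists_pseudo_separating hA isClosed_closure hAB
  refine ⟨d, hd, fun l hl => ?_⟩
  have hl1 := hl.comp heven.tendsto_atTop
  have hl0 := hl.comp hodd.tendsto_atTop
  have e1 : (fun n => d (u n, v n)) ∘ (fun i => f (2 * i)) = fun _ => (1 : ℝ) :=
    funext fun i => h1 _ ⟨i, rfl⟩ _ (subset_closure (Or.inr ⟨2 * i, rfl⟩))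
  have e0 : (fun n => d (u n, v n)) ∘ (fun i => f (2 * i + 1)) = fun _ => (0 : ℝ) :=
    funext fun i => h0 _ (subset_closure (Or.inl ⟨i, rfl⟩)) _
      (subset_closure (Or.inr ⟨2 * i + 1, rfl⟩))
  rw [e1] at hl1
  rw [e0] at hl0
  exact one_ne_zero ((tendsto_nhds_unique tendsto_const_nhds hl1).trans
    (tendsto_nhds_unique tendsto_const_nhds hl0).symm)

/-- If all pseudometrics converge along `(u n, v n)`, then `u` has a convergent subsequence. After
passing to a subsequence, `v` does not accumulate at any term of `u`: if `v` accumulates somewhere,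
take `v` convergent to some `c` and drop the finitely many terms of `u` equal to `c`. -/
theorem exists_subseq_tendsto {u v : ℕ → Y} (huv : ∀ n, u n ≠ v n)
    (hconv : ∀ d ∈ pseudo Y, ∃ l, Tendsto (fun n => d (u n, v n)) atTop (𝓝 l)) :
    ∃ (y : Y) (ν : ℕ → ℕ), StrictMono ν ∧ Tendsto (u ∘ ν) atTop (𝓝 y) := by
  by_contra! hno
  have hu : ∀ y, ¬ MapClusterPt y atTop u := fun y hy => by
    obtain ⟨ν, hν, h⟩ := hy.tendsto_subseq
    exact hno y ν hν h
  obtain ⟨ν, hν, hv⟩ : ∃ ν : ℕ → ℕ, Tendsto ν atTop atTop ∧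
      ∀ n, ¬ MapClusterPt (u (ν n)) atTop (v ∘ ν) := by
    by_cases hc : ∃ c, MapClusterPt c atTop v
    · obtain ⟨c, hc⟩ := hc
      obtain ⟨ν, hν, h⟩ := hc.tendsto_subseq
      obtain ⟨N, hN⟩ := eventually_atTop.1
        (hν.tendsto_atTop.eventually (eventually_ne_of_not_mapClusterPt (hu c)))
      refine ⟨fun n => ν (n + N), hν.tendsto_atTop.comp (tendsto_add_atTop_nat N), fun n hn => ?_⟩
      have hlim : Tendsto (v ∘ fun n => ν (n + N)) atTop (𝓝 c) :=
        h.comp (tendsto_add_atTop_nat N)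
      have : (𝓝 (u (ν (n + N))) ⊓ 𝓝 c).NeBot := NeBot.mono hn (inf_le_inf_left _ hlim)
      exact hN (n + N) (by lia) (eq_of_nhds_neBot this)
    · push Not at hc
      exact ⟨id, tendsto_id, fun n => hc _⟩
  obtain ⟨d, hd, h⟩ := exists_pseudo_not_tendsto (u := u ∘ ν) (v := v ∘ ν) (fun n => huv _)
    (fun y hy => hu y (hy.of_comp hν)) hv
  obtain ⟨l, hl⟩ := hconv d hd
  exact h l (hl.comp hν)

/-- A surjective isometry turns evaluation at a pair of distinct points into evaluation at a
pair of points. -/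
theorem exists_eval_eq {X : Type*} [TopologicalSpace X] [MetrizableSpace X] [Nonempty Y]
    (T : pseudo X ≃ᵢ pseudo Y) {z w : X} (hzw : z ≠ w) :
    ∃ a b : Y, ∀ d : pseudo X, (T d).1 (a, b) = d.1 (z, w) := by
  obtain ⟨u, v, huv⟩ := exists_seq_tendsto_eval T hzw
  obtain ⟨p, hp, hp0, hpzw, -⟩ := exists_strict_peak hzw
  have hev : ∀ᶠ n in atTop, u n ≠ v n := by
    have h := (huv ⟨p, hp⟩).eventually_const_lt (show 0 < p (z, w) by rwa [hpzw])
    filter_upwards [h] with n hn hn'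
    rw [hn', (T _).2.2.1] at hn
    exact lt_irrefl _ hn
  obtain ⟨N, hN⟩ := eventually_atTop.1 hev
  have hlim : ∀ d ∈ pseudo Y, ∃ l, Tendsto (fun n => d (u (n + N), v (n + N))) atTop (𝓝 l) := by
    intro d hd
    have h := (huv (T.symm ⟨d, hd⟩)).comp (tendsto_add_atTop_nat N)
    rw [T.apply_symm_apply] at h
    exact ⟨_, h⟩
  have hne : ∀ n, u (n + N) ≠ v (n + N) := fun n => hN _ (by lia)
  obtain ⟨a, ν, hν, ha⟩ := exists_subseq_tendsto hne hlim
  obtain ⟨b, κ, hκ, hb⟩ := exists_subseq_tendsto (u := fun n => v (ν n + N))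
    (v := fun n => u (ν n + N)) (fun n => (hne _).symm) (fun d hd => by
      obtain ⟨l, hl⟩ := hlim d hd
      refine ⟨l, ?_⟩
      simpa only [hd.2.2.1, Function.comp_def] using hl.comp hν.tendsto_atTop)
  refine ⟨a, b, fun d => ?_⟩
  have h1 : Tendsto (fun n => (T d).1 (u (ν (κ n) + N), v (ν (κ n) + N))) atTop
      (𝓝 ((T d).1 (a, b))) :=
    ((T d).1.continuous.tendsto (a, b)).comp
      ((ha.comp hκ.tendsto_atTop).prodMk_nhds hb)
  exact tendsto_nhds_unique h1 ((huv d).comp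
    ((tendsto_add_atTop_nat N).comp (hν.tendsto_atTop.comp hκ.tendsto_atTop)))

end Sequences

/-! ### Triangle-preserving maps between complete graphs -/

section Edges

/-- The images of the edges of a triangle form a triangle. -/
theorem exists_triangle {X Y : Type*} (E : Y → Y → Sym2 X)
    (hsymm : ∀ a b, E a b = E b a) (hdiag : ∀ a b, a ≠ b → ¬ (E a b).IsDiag)
    (hinj : ∀ a b c d, a ≠ b → c ≠ d → E a b = E c d → s(a, b) = s(c, d))
    (htri : ∀ a b c, a ≠ b → a ≠ c → b ≠ c → ∀ x ∈ E a b, x ∈ E a c ∨ x ∈ E b c)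
    {y u v : Y} (hyu : y ≠ u) (hyv : y ≠ v) (huv : u ≠ v) :
    ∃ a b c, E y u = s(a, b) ∧ E y v = s(a, c) ∧ E u v = s(b, c) ∧ a ≠ b ∧ a ≠ c ∧ b ≠ c := by
  classical
  have h1 := htri y u v hyu hyv huv
  have h2 := htri y v u hyv hyu huv.symm
  have h3 := htri u v y huv hyu.symm hyv.symm
  have n1 : E y u ≠ E y v := fun h => by
    have := hinj _ _ _ _ hyu hyv h
    rw [Sym2.eq_iff] at this
    grind
  have d1 := hdiag y u hyu
  have d2 := hdiag y v hyv
  have d3 := hdiag u v huv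
  rw [hsymm v u] at h2
  rw [hsymm u y, hsymm v y] at h3
  generalize E y u = e1 at *
  generalize E y v = e2 at *
  generalize E u v = e3 at *
  clear hsymm hdiag hinj htri hyu hyv huv
  induction e1 with | _ p q
  induction e2 with | _ p' q'
  induction e3 with | _ p'' q''
  simp only [Sym2.mem_iff, Sym2.mk_isDiag_iff, ne_eq, Sym2.eq_iff] at *
  have a1 := h1 p (Or.inl rfl)
  have a2 := h1 q (Or.inr rfl)
  have a3 := h2 p' (Or.inl rfl)
  have a4 := h2 q' (Or.inr rfl)
  have a5 := h3 p'' (Or.inl rfl)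
  have a6 := h3 q'' (Or.inr rfl)
  clear h1 h2 h3
  by_cases hp : p = p' ∨ p = q'
  · refine ⟨p, q, if p = p' then q' else p', ?_⟩
    grind
  · refine ⟨q, p, if q = p' then q' else p', ?_⟩
    grind

/-- An injective map between the edges of complete graphs which maps triangles to triangles (every
endpoint of an edge of the image of a triangle lies on another of its edges) is induced by a map of
vertices. -/
theorem exists_vertex_map {X Y : Type*} [Nontrivial Y] (E : Y → Y → Sym2 X)
    (hsymm : ∀ a b, E a b = E b a) (hdiag : ∀ a b, a ≠ b → ¬ (E a b).IsDiag)
    (hinj : ∀ a b c d, a ≠ b → c ≠ d → E a b = E c d → s(a, b) = s(c, d))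
    (htri : ∀ a b c, a ≠ b → a ≠ c → b ≠ c → ∀ x ∈ E a b, x ∈ E a c ∨ x ∈ E b c) :
    ∃ φ : Y → X, ∀ a b, a ≠ b → E a b = s(φ a, φ b) := by
  classical
  by_cases hcard : ∃ a b c : Y, a ≠ b ∧ a ≠ c ∧ b ≠ c
  · have hthird : ∀ x y : Y, ∃ v, x ≠ v ∧ y ≠ v := by
      obtain ⟨a, b, c, hab, hac, hbc⟩ := hcard
      clear hsymm hdiag hinj htri
      intro x y
      by_contra! h
      have ha := h a
      have hb := h b
      have hc := h c
      clear h
      by_cases x = a <;> by_cases x = b <;> grind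
    have hshape := fun y u v => exists_triangle E hsymm hdiag hinj htri (y := y) (u := u) (v := v)
    have hstar : ∀ y, ∃ a, ∀ u, y ≠ u → a ∈ E y u := by
      intro y
      obtain ⟨u, v, hyu, hyv, huv⟩ : ∃ u v, y ≠ u ∧ y ≠ v ∧ u ≠ v := by
        obtain ⟨u, hu, -⟩ := hthird y y
        obtain ⟨v, hv, huv⟩ := hthird y u
        exact ⟨u, v, hu, hv, huv⟩
      obtain ⟨a, b, c, e1, e2, e3, hab, hac, hbc⟩ := hshape y u v hyu hyv huv
      refine ⟨a, fun w hyw => ?_⟩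
      by_cases hwu : w = u
      · rw [hwu, e1]
        simp
      by_cases hwv : w = v
      · rw [hwv, e2]
        simp
      obtain ⟨a1, b1, c1, f1, f2, -, -⟩ := hshape y u w hyu hyw (Ne.symm hwu)
      obtain ⟨a2, b2, c2, g1, g2, -, -⟩ := hshape y v w hyv hyw (Ne.symm hwv)
      -- otherwise the edges `y w` and `u v` would have the same image
      by_contra ha
      have hw : E y w = E u v := by
        rw [e3]
        rw [e1] at f1
        rw [e2] at g1
        rw [f2] at g2 ha
        rw [f2]
        simp only [Sym2.eq_iff, Sym2.mem_iff] at *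
        grind
      have := hinj _ _ _ _ hyw huv hw
      rw [Sym2.eq_iff] at this
      grind
    choose φ hφ using hstar
    refine ⟨φ, fun x y hxy => ?_⟩
    have hx := hφ x y hxy
    have hy := hφ y x hxy.symm
    rw [hsymm y x] at hy
    have hne : φ x ≠ φ y := by
      obtain ⟨v, hxv, hyv⟩ := hthird x y
      intro h
      have hxv' := hφ x v hxv
      have hyv' := hφ y v hyv
      obtain ⟨a, b, c, e1, e2, e3, hab, hac, hbc⟩ := hshape x y v hxy hxv hyv
      rw [e1] at hx
      rw [e2] at hxv'
      rw [e3, ← h] at hyv'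
      simp only [Sym2.mem_iff] at *
      grind
    exact (Sym2.mem_and_mem_iff hne).1 ⟨hx, hy⟩
  · obtain ⟨a, b, hab⟩ := exists_pair_ne Y
    push Not at hcard
    have hall : ∀ y, y = a ∨ y = b := fun y => by
      by_contra! h
      exact h.2 (hcard a b y hab h.1.symm).symm
    obtain ⟨z, w, hzw⟩ : ∃ z w, E a b = s(z, w) := (E a b).ind fun z w => ⟨z, w, rfl⟩
    refine ⟨fun y => if y = a then z else w, fun x y hxy => ?_⟩
    rcases hall x with rfl | rfl <;> rcases hall y with rfl | rfl
    · exact (hxy rfl).elim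
    · simp [hzw, hab.symm]
    · rw [hsymm, hzw]
      simp [hab.symm, Sym2.eq_swap]
    · exact (hxy rfl).elim

end Edges

/-! ### Isometries are induced by homeomorphisms -/

section Representation

variable {X Y : Type*} [TopologicalSpace X] [MetrizableSpace X] [TopologicalSpace Y]
  [MetrizableSpace Y]

theorem subsingleton_of_isometry [Nonempty Y] [Subsingleton Y] (T : pseudo X ≃ᵢ pseudo Y) :
    Subsingleton X := by
  refine ⟨fun z w => ?_⟩
  by_contra hzw
  obtain ⟨a, b, h⟩ := exists_eval_eq T hzw
  obtain ⟨p, hp, hp0, hpzw, -⟩ := exists_strict_peak hzw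
  have := h ⟨p, hp⟩
  rw [Subsingleton.elim b a, (T _).2.2.1] at this
  simp only [hpzw] at this
  exact hp0.ne this

/-- A map pulling back all pseudometrics of `X` to continuous functions is continuous. -/
theorem continuous_of_forall_pseudo {X Y : Type*} [TopologicalSpace X] [MetrizableSpace X]
    [TopologicalSpace Y] {φ : Y → X}
    (h : ∀ d ∈ pseudo X, ∀ y, Continuous fun y' => d (φ y', φ y)) : Continuous φ := by
  let := metrizableSpaceMetric X
  rw [continuous_iff_continuousAt]
  intro y
  obtain ⟨d, hd, hdf⟩ := exists_pseudo_abs_sub (h := fun x => min (dist x (φ y)) 1)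
    (by fun_prop) (B := 1) (fun x => by
      rw [abs_of_nonneg (le_min dist_nonneg zero_le_one)]
      exact min_le_right _ _)
  rw [ContinuousAt, tendsto_iff_dist_tendsto_zero]
  have h1 := (h d hd y).tendsto y
  simp only [hdf, dist_self, zero_le_one, min_eq_left, sub_zero, abs_zero] at h1
  rw [Metric.tendsto_nhds] at h1 ⊢
  intro ε hε
  filter_upwards [h1 (min ε 1) (lt_min hε one_pos)] with y' hy'
  rw [Real.dist_eq, sub_zero, abs_abs, abs_of_nonneg (le_min dist_nonneg zero_le_one)] at hy'
  rw [Real.dist_eq, sub_zero, abs_of_nonneg dist_nonneg]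
  rcases min_lt_iff.1 (hy'.trans_le (min_le_right ε 1)) with h2 | h2
  · rw [min_eq_left h2.le] at hy'
    exact hy'.trans_le (min_le_left _ _)
  · exact (lt_irrefl _ h2).elim

/-- Every surjective isometry between spaces of pseudometrics is induced by a homeomorphism. -/
theorem exists_homeomorph_of_isometry (hXY : IsEmpty X ↔ IsEmpty Y) (T : pseudo X ≃ᵢ pseudo Y) :
    ∃ φ : Y ≃ₜ X, ∀ (d : pseudo X) (x y : Y), (T d).1 (x, y) = d.1 (φ x, φ y) := by
  rcases isEmpty_or_nonempty Y with hY | hY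
  · have hX := hXY.2 hY
    exact ⟨Homeomorph.empty, fun d x => isEmptyElim x⟩
  have hX : Nonempty X := by
    rw [← not_isEmpty_iff, hXY, not_isEmpty_iff]
    exact hY
  rcases subsingleton_or_nontrivial Y with hY1 | hY1
  · have hX1 := subsingleton_of_isometry T
    let := uniqueOfSubsingleton (Classical.arbitrary X)
    let := uniqueOfSubsingleton (Classical.arbitrary Y)
    refine ⟨Homeomorph.homeomorphOfUnique Y X, fun d x y => ?_⟩
    rw [Subsingleton.elim y x, (T d).2.2.1, d.2.2.1]
  -- `E a b` is the pair of points of `X` corresponding to the pair `{a, b}`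
  have hpair : ∀ a b : Y, ∃ e : Sym2 X, ∃ z w, e = s(z, w) ∧
      ∀ d : pseudo X, (T d).1 (a, b) = d.1 (z, w) := by
    intro a b
    rcases eq_or_ne a b with rfl | hab
    · exact ⟨_, Classical.arbitrary X, Classical.arbitrary X, rfl, fun d => by
        rw [(T d).2.2.1, d.2.2.1]⟩
    · obtain ⟨z, w, h⟩ := exists_eval_eq T.symm hab
      exact ⟨_, z, w, rfl, fun d => by rw [← h, T.symm_apply_apply]⟩
  choose E z w hEzw hd using hpair
  have hY2 : ∀ a b a' b', a ≠ b → (∀ d : pseudo X, (T d).1 (a, b) = (T d).1 (a', b')) →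
      s(a, b) = s(a', b') := fun a b a' b' hab h => sym2_eq_of_forall_pseudo hab fun e he => by
    have := h (T.symm ⟨e, he⟩)
    rwa [T.apply_symm_apply] at this
  have heval : ∀ a b p q, E a b = s(p, q) → ∀ d : pseudo X, (T d).1 (a, b) = d.1 (p, q) := by
    intro a b p q h d
    rw [hEzw] at h
    rcases Sym2.eq_iff.1 h with ⟨h1, h2⟩ | ⟨h1, h2⟩
    · rw [hd, h1, h2]
    · rw [hd, h1, h2, d.2.2.2.1]
  have hzw : ∀ a b, a ≠ b → z a b ≠ w a b := by
    intro a b hab h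
    have := hY2 a b a a hab fun d => by rw [hd, h, d.2.2.1, (T d).2.2.1]
    rw [Sym2.eq_iff] at this
    grind
  have hdiag : ∀ a b, a ≠ b → ¬ (E a b).IsDiag := fun a b hab h => by
    rw [hEzw, Sym2.mk_isDiag_iff] at h
    exact hzw a b hab h
  have hsymm : ∀ a b, E a b = E b a := by
    intro a b
    rcases eq_or_ne a b with rfl | hab
    · rfl
    rw [hEzw, hEzw]
    refine sym2_eq_of_forall_pseudo (hzw a b hab) fun d hdX => ?_
    have h1 := hd a b ⟨d, hdX⟩
    rw [(T _).2.2.2.1, hd b a ⟨d, hdX⟩] at h1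
    exact h1.symm
  have hinj : ∀ a b c d, a ≠ b → c ≠ d → E a b = E c d → s(a, b) = s(c, d) := by
    intro a b a' b' hab _ h
    refine hY2 _ _ _ _ hab fun d => ?_
    rw [heval a b _ _ (h.trans (hEzw a' b')), hd]
  -- the triangle inequality in `Y`, tested on an indicator of `x`
  have htri : ∀ a b c, a ≠ b → a ≠ c → b ≠ c → ∀ x ∈ E a b, x ∈ E a c ∨ x ∈ E b c := by
    intro a b c hab hac hbc x hx
    by_contra! hx'
    obtain ⟨d, hdX, hi⟩ := exists_pseudo_indicator x
      (S := {z a b, w a b, z a c, w a c, z b c, w b c}) (by simp)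
    have e1 := (hi (E a b) (hdiag a b hab) (by simp [hEzw]) _ _ (hEzw a b)).1 hx
    have e2 := (hi (E a c) (hdiag a c hac) (by simp [hEzw]) _ _ (hEzw a c)).2 hx'.1
    have e3 := (hi (E b c) (hdiag b c hbc) (by simp [hEzw]) _ _ (hEzw b c)).2 hx'.2
    have := (T ⟨d, hdX⟩).2.2.2.2 a c b
    rw [(T _).2.2.2.1 c b, hd, hd, hd] at this
    simp only [e1, e2, e3] at this
    norm_num at this
  obtain ⟨φ, hφ⟩ := exists_vertex_map E hsymm hdiag hinj htri
  have hT : ∀ (d : pseudo X) (x y : Y), (T d).1 (x, y) = d.1 (φ x, φ y) := by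
    intro d x y
    rcases eq_or_ne x y with rfl | hxy
    · rw [(T d).2.2.1, d.2.2.1]
    · exact heval x y _ _ (hφ x y hxy) d
  have hφinj : Function.Injective φ := by
    intro x y hxy
    by_contra hne
    apply hdiag x y hne
    rw [hφ x y hne, hxy]
    exact Sym2.mk_isDiag_iff.2 rfl
  have hφsurj : Function.Surjective φ := by
    have : Nontrivial X := hφinj.nontrivial
    intro a
    obtain ⟨b, hb⟩ := exists_ne a
    obtain ⟨x, y, h⟩ := exists_eval_eq T hb.symm
    have hs := sym2_eq_of_forall_pseudo hb.symm fun d hdX => (h ⟨d, hdX⟩).symm.trans (hT _ x y)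
    have ha : a ∈ s(φ x, φ y) := hs ▸ Sym2.mem_mk_left a b
    rcases Sym2.mem_iff.1 ha with ha | ha
    · exact ⟨x, ha.symm⟩
    · exact ⟨y, ha.symm⟩
  let ψ : Y ≃ X := Equiv.ofBijective φ ⟨hφinj, hφsurj⟩
  have hψ : ∀ x, φ (ψ.symm x) = x := fun x => ψ.apply_symm_apply x
  refine ⟨⟨ψ, continuous_of_forall_pseudo fun d hdX y => ?_,
    continuous_of_forall_pseudo fun e he x => ?_⟩, hT⟩
  · have h : (fun y' => d (ψ y', ψ y)) = fun y' => (T ⟨d, hdX⟩).1 (y', y) :=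
      funext fun y' => (hT ⟨d, hdX⟩ y' y).symm
    change Continuous fun y' => d (ψ y', ψ y)
    rw [h]
    fun_prop
  · have h : (fun x' => e (ψ.symm x', ψ.symm x)) = fun x' => (T.symm ⟨e, he⟩).1 (x', x) := by
      funext x'
      have h1 := hT (T.symm ⟨e, he⟩) (ψ.symm x') (ψ.symm x)
      rwa [T.apply_symm_apply, hψ, hψ] at h1
    change Continuous fun x' => e (ψ.symm x', ψ.symm x)
    rw [h]
    fun_prop

end Representation

/-! ### Uniqueness of the homeomorphism -/

section Uniqueness

variable {X Y : Type*} [TopologicalSpace X] [MetrizableSpace X] [TopologicalSpace Y]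

/-- A homeomorphism is determined by its action on pseudometrics. On a two-point space this fails,
since transposing the points preserves all pseudometrics. -/
theorem homeomorph_eq_of_forall_pseudo (hcard : Nat.card Y ≠ 2) {φ ψ : Y ≃ₜ X}
    (h : ∀ d ∈ pseudo X, ∀ x y, d (φ x, φ y) = d (ψ x, ψ y)) : φ = ψ := by
  ext y
  by_contra hne
  obtain ⟨u, hu⟩ : ∃ u, y ≠ u := ⟨φ.symm (ψ y), fun hy => hne (by
    conv_lhs => rw [hy, φ.apply_symm_apply])⟩
  obtain ⟨v, hyv, huv⟩ : ∃ v, y ≠ v ∧ u ≠ v := by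
    by_contra! hv
    refine hcard (Nat.card_eq_two_iff.2 ⟨y, u, hu, Set.eq_univ_of_forall fun v => ?_⟩)
    by_cases hyv : y = v
    · exact Or.inl hyv.symm
    · exact Or.inr (hv v hyv).symm
  have key : ∀ x, y ≠ x → φ y = ψ x := fun x hx => by
    have := sym2_eq_of_forall_pseudo (φ.injective.ne hx) fun d hd => h d hd y x
    rcases Sym2.eq_iff.1 this with h1 | h1
    · exact (hne h1.1).elim
    · exact h1.1
  exact huv (ψ.injective ((key u hu).symm.trans (key v hyv)))

end Uniqueness

/-! ### Pullback along a homeomorphism -/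

section Pullback

variable {X Y : Type*} [TopologicalSpace X] [TopologicalSpace Y]

/-- The pullback of a function on `X × X` along a homeomorphism `h : Y ≃ₜ X`. -/
def pullback (h : Y ≃ₜ X) (d : X × X →ᵇ ℝ) : Y × Y →ᵇ ℝ :=
  d.compContinuous ⟨fun q => (h q.1, h q.2), by fun_prop⟩

theorem pullback_apply (h : Y ≃ₜ X) (d : X × X →ᵇ ℝ) (x y : Y) :
    pullback h d (x, y) = d (h x, h y) :=
  rfl

theorem pullback_pullback_symm (h : Y ≃ₜ X) (e : Y × Y →ᵇ ℝ) :
    pullback h (pullback h.symm e) = e := by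
  ext ⟨x, y⟩
  simp [pullback_apply]

theorem pullback_symm_pullback (h : Y ≃ₜ X) (d : X × X →ᵇ ℝ) :
    pullback h.symm (pullback h d) = d := by
  ext ⟨x, y⟩
  simp [pullback_apply]

theorem dist_pullback_le (h : Y ≃ₜ X) (d e : X × X →ᵇ ℝ) :
    dist (pullback h d) (pullback h e) ≤ dist d e :=
  (BoundedContinuousFunction.dist_le dist_nonneg).2 fun q =>
    BoundedContinuousFunction.dist_coe_le_dist (f := d) (g := e) (h q.1, h q.2)

theorem dist_pullback (h : Y ≃ₜ X) (d e : X × X →ᵇ ℝ) :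
    dist (pullback h d) (pullback h e) = dist d e := by
  refine le_antisymm (dist_pullback_le h d e) ?_
  have := dist_pullback_le h.symm (pullback h d) (pullback h e)
  rwa [pullback_symm_pullback, pullback_symm_pullback] at this

theorem norm_pullback (h : Y ≃ₜ X) (d : X × X →ᵇ ℝ) : ‖pullback h d‖ = ‖d‖ := by
  have h0 : pullback h (0 : X × X →ᵇ ℝ) = 0 := rfl
  rw [← dist_zero_right, ← h0, dist_pullback, dist_zero_right]

theorem pullback_mem_pseudo (h : Y ≃ₜ X) {d : X × X →ᵇ ℝ} (hd : d ∈ pseudo X) :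
    pullback h d ∈ pseudo Y :=
  ⟨fun _ _ => hd.1 _ _, fun _ => hd.2.1 _, fun _ _ => hd.2.2.1 _ _, fun _ _ _ => hd.2.2.2 _ _ _⟩

theorem pullback_mem_adm (h : Y ≃ₜ X) {d : X × X →ᵇ ℝ} (hd : d ∈ adm X) :
    pullback h d ∈ adm Y := by
  refine ⟨pullback_mem_pseudo h hd.1, fun x y hxy => h.injective (hd.2.1 _ _ hxy), fun U => ?_⟩
  rw [← h.symm.isOpen_preimage, hd.2.2]
  constructor
  · intro hU x hx
    obtain ⟨ε, hε, hsub⟩ := hU (h x) (by simpa using hx)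
    refine ⟨ε, hε, fun y hy => ?_⟩
    simpa using hsub (show h y ∈ {y | d (h x, y) < ε} from hy)
  · intro hU x hx
    obtain ⟨ε, hε, hsub⟩ := hU (h.symm x) hx
    refine ⟨ε, hε, fun y hy => hsub ?_⟩
    change d (h (h.symm x), h (h.symm y)) < ε
    simpa using hy

theorem pullback_mem_metr (k : PeakKind) (h : Y ≃ₜ X) {d : X × X →ᵇ ℝ} (hd : d ∈ metr k X) :
    pullback h d ∈ metr k Y := by
  cases k with
  | compact =>
    obtain ⟨hA, K, hK, hpeak⟩ := hd
    refine ⟨pullback_mem_adm h hA, h ⁻¹' K, h.isCompact_preimage.2 hK, fun x y hxy => ?_⟩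
    rw [norm_pullback] at hxy
    exact hpeak _ _ hxy
  | point =>
    obtain ⟨hA, z, w, hzw, huniq⟩ := hd
    refine ⟨pullback_mem_adm h hA, h.symm z, h.symm w, ?_, fun x y hxy => ?_⟩
    · rw [norm_pullback, pullback_apply, h.apply_symm_apply, h.apply_symm_apply, hzw]
    · rw [norm_pullback] at hxy
      have := congrArg (Set.image h.symm) (huniq _ _ hxy)
      simpa only [Set.image_pair, h.symm_apply_apply] using this

/-- Pullback is an isometry `A → B` carrying `M` onto `N` as soon as it and its inverse respect
these sets. -/
theorem exists_isometryEquiv_pullback (h : Y ≃ₜ X) {A M : Set (X × X →ᵇ ℝ)}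
    {B N : Set (Y × Y →ᵇ ℝ)} (hAB : ∀ d ∈ A, pullback h d ∈ B)
    (hBA : ∀ e ∈ B, pullback h.symm e ∈ A) (hMN : ∀ d ∈ M, pullback h d ∈ N)
    (hNM : ∀ e ∈ N, pullback h.symm e ∈ M) (hMA : M ⊆ A) :
    ∃ T : A ≃ᵢ B, CarriesOnto T M N := by
  refine ⟨⟨⟨fun d => ⟨pullback h d.1, hAB _ d.2⟩, fun e => ⟨pullback h.symm e.1, hBA _ e.2⟩,
    fun d => Subtype.ext (pullback_symm_pullback h d.1),
    fun e => Subtype.ext (pullback_pullback_symm h e.1)⟩,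
    Isometry.of_dist_eq fun d e => dist_pullback h d.1 e.1⟩, ?_⟩
  refine Set.Subset.antisymm ?_ fun e he => ?_
  · rintro _ ⟨_, ⟨d, hd, rfl⟩, rfl⟩
    exact hMN _ hd
  · exact ⟨_, ⟨⟨pullback h.symm e, hMA (hNM _ he)⟩, hNM _ he, rfl⟩, pullback_pullback_symm h e⟩

end Pullback

/-! ### Restriction and extension of isometries -/

section Restriction

variable {E F : Type*} [MetricSpace E] [MetricSpace F]

theorem nonempty_isometryEquiv_of_carriesOnto {A M : Set E} {B N : Set F} (hMA : M ⊆ A)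
    (hNB : N ⊆ B) (T : A ≃ᵢ B) (hT : CarriesOnto T M N) : Nonempty (M ≃ᵢ N) := by
  have h1 : ∀ m : M, (T ⟨m, hMA m.2⟩ : F) ∈ N := fun m =>
    hT.subset ⟨_, ⟨⟨m, hMA m.2⟩, m.2, rfl⟩, rfl⟩
  have h2 : ∀ n : N, (T.symm ⟨n, hNB n.2⟩ : E) ∈ M := fun n => by
    obtain ⟨_, ⟨a, ha, rfl⟩, h⟩ := hT.superset n.2
    have h' : (⟨n, hNB n.2⟩ : B) = T a := Subtype.ext h.symm
    rw [h', T.symm_apply_apply]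
    exact ha
  let e : M ≃ N :=
    { toFun := fun m => ⟨_, h1 m⟩
      invFun := fun n => ⟨_, h2 n⟩
      left_inv := fun m => by simp
      right_inv := fun n => by simp }
  exact ⟨⟨e, Isometry.of_dist_eq fun m m' => T.dist_eq ⟨m, hMA m.2⟩ ⟨m', hMA m'.2⟩⟩⟩

/-- A complete set as the completion of a dense subset. -/
def denseCompletion {M P : Set E} (hMP : M ⊆ P) (hP : IsComplete P) (hd : P ⊆ closure M) :
    AbstractCompletion M where
  space := P
  coe := Set.inclusion hMP
  uniformStruct := inferInstance
  complete := hP.completeSpace_coe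
  separation := inferInstance
  isUniformInducing :=
    (Isometry.of_dist_eq (f := Set.inclusion hMP) fun _ _ => rfl).isUniformInducing
  dense := (denseRange_inclusion_iff hMP).2 hd

theorem nonempty_isometryEquiv_of_dense {M P : Set E} {N Q : Set F} (hMP : M ⊆ P)
    (hP : IsComplete P) (hPM : P ⊆ closure M) (hNQ : N ⊆ Q) (hQ : IsComplete Q)
    (hQN : Q ⊆ closure N) (T : M ≃ᵢ N) : Nonempty (P ≃ᵢ Q) := by
  let cM := denseCompletion hMP hP hPM
  let cN := denseCompletion hNQ hQ hQN
  let T' : M ≃ᵤ N :=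
    { T.toEquiv with
      uniformContinuous_toFun := T.isometry.uniformContinuous
      uniformContinuous_invFun := T.symm.isometry.uniformContinuous }
  let S : P ≃ᵤ Q := cM.mapEquiv cN T'
  have hS : ∀ m : M, S (Set.inclusion hMP m) = Set.inclusion hNQ (T m) := fun m =>
    cM.mapEquiv_coe cN T' m
  have hdense : DenseRange (Set.inclusion hMP) := (denseRange_inclusion_iff hMP).2 hPM
  refine ⟨⟨S.toEquiv, Isometry.of_dist_eq fun p q => ?_⟩⟩
  have hc : Continuous S := S.continuous
  change dist (S p) (S q) = dist p q
  refine hdense.induction_on₂ (p := fun p q => dist (S p) (S q) = dist p q) ?_ ?_ p q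
  · exact isClosed_eq (by fun_prop) (by fun_prop)
  · intro m m'
    rw [hS, hS]
    exact T.dist_eq m m'

end Restriction

/-! ### Density of the peaking metrics -/

section Density

variable {X : Type*} [TopologicalSpace X]

theorem isComplete_pseudo : IsComplete (pseudo X) := by
  refine IsClosed.isComplete ?_
  have he : ∀ q : X × X, Continuous fun d : X × X →ᵇ ℝ => d q := fun q =>
    continuous_eval_const q
  simp only [pseudo, Set.ofPred_and, Set.ofPred_forall]
  refine .inter ?_ (.inter ?_ (.inter ?_ ?_))
  · exact isClosed_iInter fun x => isClosed_iInter fun y => isClosed_le continuous_const (he _)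
  · exact isClosed_iInter fun x => isClosed_eq (he _) continuous_const
  · exact isClosed_iInter fun x => isClosed_iInter fun y => isClosed_eq (he _) (he _)
  · exact isClosed_iInter fun x => isClosed_iInter fun y => isClosed_iInter fun z =>
      isClosed_le (he _) ((he _).add (he _))

theorem metr_subset_adm (k : PeakKind) : metr k X ⊆ adm X := by
  cases k <;> exact fun d hd => hd.1

theorem adm_subset_pseudo : adm X ⊆ pseudo X := fun _ hd => hd.1

theorem Pp_subset_metr (k : PeakKind) : Pp X ⊆ metr k X := by
  cases k with
  | compact =>
    rintro d ⟨hA, z, w, hzw, huniq⟩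
    refine ⟨hA, {z, w}, (Set.toFinite _).isCompact, fun x y hxy => ?_⟩
    rw [← huniq x y hxy]
    simp
  | point => exact subset_rfl

variable [MetrizableSpace X]

/-- Some bounded metric `ρ` has the property that every continuous pseudometric dominating a
truncated positive multiple of `ρ` is admissible; any metric inducing the topology, truncated at
one, will do. -/
theorem exists_adm_of_le : ∃ ρ ∈ pseudo X, (∀ x y, x ≠ y → 0 < ρ (x, y)) ∧
    ∀ g ∈ pseudo X, ∀ κ > 0, ∀ c > 0, (∀ x y, min (κ * ρ (x, y)) c ≤ g (x, y)) → g ∈ adm X := by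
  let := metrizableSpaceMetric X
  let ρ₀ : X × X →ᵇ ℝ := BoundedContinuousFunction.ofNormedAddCommGroup
    (fun q : X × X => min (dist q.1 q.2) 1) (by fun_prop) 1 (fun q => by
      rw [Real.norm_eq_abs, abs_of_nonneg (le_min dist_nonneg zero_le_one)]
      exact min_le_right _ _)
  have hρ₀ : ∀ x y, ρ₀ (x, y) = min (dist x y) 1 := fun x y => rfl
  refine ⟨ρ₀, ⟨fun x y => ?_, fun x => ?_, fun x y => ?_, fun x y z => ?_⟩, fun x y hxy => ?_, ?_⟩
  · exact le_min dist_nonneg zero_le_one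
  · simp [hρ₀]
  · simp [hρ₀, dist_comm]
  · rw [hρ₀, hρ₀, hρ₀]
    have h1 := dist_triangle x y z
    have h2 : 0 ≤ dist x y := dist_nonneg
    have h3 : 0 ≤ dist y z := dist_nonneg
    rcases min_cases (dist x z) 1 with h | h <;> rcases min_cases (dist x y) 1 with h' | h' <;>
      rcases min_cases (dist y z) 1 with h'' | h'' <;> linarith
  · exact lt_min (dist_pos.2 hxy) one_pos
  · intro g hg κ hκ c hc hle
    refine ⟨hg, fun x y hxy => ?_, fun U => ⟨fun hU x hx => ?_, fun hU => ?_⟩⟩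
    · by_contra hne
      have h1 : 0 < min (κ * ρ₀ (x, y)) c :=
        lt_min (mul_pos hκ (lt_min (dist_pos.2 hne) one_pos)) hc
      linarith [hle x y]
    · obtain ⟨ε, hε, hsub⟩ := Metric.isOpen_iff.1 hU x hx
      refine ⟨min (κ * min ε 1) c, lt_min (mul_pos hκ (lt_min hε one_pos)) hc, fun y hy => hsub ?_⟩
      have h1 : min (κ * ρ₀ (x, y)) c < min (κ * min ε 1) c := (hle x y).trans_lt hy
      have h2 : κ * ρ₀ (x, y) < κ * min ε 1 := by
        rcases min_lt_iff.1 h1 with h | h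
        · exact h.trans_le (min_le_left _ _)
        · exact (lt_irrefl _ (h.trans_le (min_le_right _ _))).elim
      have h3 : min (dist x y) 1 < min ε 1 := lt_of_mul_lt_mul_left h2 hκ.le
      rw [Metric.mem_ball, dist_comm]
      rcases min_lt_iff.1 h3 with h | h
      · exact h.trans_le (min_le_left _ _)
      · exact (lt_irrefl _ (h.trans_le (min_le_right _ _))).elim
    · rw [isOpen_iff_mem_nhds]
      intro x hx
      obtain ⟨ε, hε, hsub⟩ := hU x hx
      have hopen : IsOpen {y | g (x, y) < ε} := isOpen_lt (by fun_prop) continuous_const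
      exact Filter.mem_of_superset (hopen.mem_nhds (by simpa [hg.2.1 x] using hε)) hsub

/-- The admissible metrics with a single peak are dense: add a small multiple of a metric, truncate
at an almost maximal value `c = d₁ (z, w)`, and add a small strict peak at `{z, w}`. -/
theorem pseudo_subset_closure_Pp [Nonempty X] : pseudo X ⊆ closure (Pp X) := by
  intro d hd
  obtain ⟨ρ, hρ, hρpos, hadm⟩ := exists_adm_of_le (X := X)
  rcases subsingleton_or_nontrivial X with hX | hX
  · apply subset_closure
    obtain ⟨x⟩ := ‹Nonempty X›
    refine ⟨hadm d hd 1 one_pos 1 one_pos fun y z => ?_, x, x, ?_, fun y z _ => ?_⟩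
    · rw [Subsingleton.elim z y, hρ.2.1, hd.2.1]
      simp
    · refine le_antisymm (le_norm_apply d _) (norm_le_of_pseudo hd (hd.1 _ _) fun y z => ?_)
      rw [Subsingleton.elim y x, Subsingleton.elim z x]
    · rw [Subsingleton.elim y x, Subsingleton.elim z x]
  rw [Metric.mem_closure_iff]
  intro ε hε
  obtain ⟨a, b, hab⟩ := exists_pair_ne X
  have hρn : 0 < ‖ρ‖ := (hρpos a b hab).trans_le (le_norm_apply ρ _)
  set κ : ℝ := ε / 4 / ‖ρ‖ with hκdef
  have hκ : 0 < κ := by positivity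
  have hκρ : κ * ‖ρ‖ = ε / 4 := by
    rw [hκdef]
    field_simp
  set d₁ : X × X →ᵇ ℝ := d + κ • ρ with hd₁def
  have hd₁ : d₁ ∈ pseudo X := add_mem_pseudo hd (smul_mem_pseudo hρ hκ.le)
  have hd₁app : ∀ q, d₁ q = d q + κ * ρ q := fun q => rfl
  have hd₁n : 0 < ‖d₁‖ := by
    have h1 := le_norm_apply d₁ (a, b)
    have h2 := mul_pos hκ (hρpos a b hab)
    rw [hd₁app] at h1
    linarith [hd.1 a b]
  obtain ⟨z, w, hzw⟩ := exists_norm_sub_lt hd₁ (ε := min (ε / 4) ‖d₁‖) (by positivity)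
  set c : ℝ := d₁ (z, w) with hc
  have hc0 : 0 < c := by linarith [min_le_right (ε / 4) ‖d₁‖]
  have hcn : ‖d₁‖ - ε / 4 < c := by linarith [min_le_left (ε / 4) ‖d₁‖]
  have hne : z ≠ w := by
    rintro rfl
    rw [hc, hd₁.2.1] at hc0
    exact lt_irrefl _ hc0
  obtain ⟨p, hp, hp0, hpzw, hpuniq, -⟩ := exists_strict_peak hne
  set s : ℝ := ε / 4 / ‖p‖ with hsdef
  have hs : 0 < s := by positivity
  have hsp : s * ‖p‖ = ε / 4 := by
    rw [hsdef]
    field_simp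
  set g : X × X →ᵇ ℝ := d₁ ⊓ BoundedContinuousFunction.const (X × X) c + s • p with hgdef
  have hg : g ∈ pseudo X :=
    add_mem_pseudo (inf_const_mem_pseudo hd₁ hc0.le) (smul_mem_pseudo hp hs.le)
  have hgapp : ∀ q, g q = min (d₁ q) c + s * p q := fun q => rfl
  have hgle : ∀ q, g q ≤ c + s * ‖p‖ := fun q =>
    add_le_add (min_le_right _ _) (mul_le_mul_of_nonneg_left (le_norm_apply p q) hs.le)
  have hgzw : g (z, w) = c + s * ‖p‖ := by rw [hgapp, ← hc, min_self, hpzw]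
  have hgn : ‖g‖ = c + s * ‖p‖ :=
    le_antisymm (norm_le_of_pseudo hg (by positivity) fun x y => hgle _)
      (hgzw ▸ le_norm_apply g _)
  refine ⟨g, ⟨hadm g hg κ hκ c hc0 fun x y => ?_, z, w, ?_, fun x y hxy => ?_⟩, ?_⟩
  · rw [hgapp, hd₁app]
    have h1 : min (κ * ρ (x, y)) c ≤ min (d (x, y) + κ * ρ (x, y)) c :=
      min_le_min_right _ (by linarith [hd.1 x y])
    have h2 := mul_nonneg hs.le (hp.1 x y)
    linarith
  · rw [hgzw, hgn]
  · have h1 : ‖p‖ ≤ p (x, y) := by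
      rw [hgn, hgapp] at hxy
      have := min_le_right (d₁ (x, y)) c
      exact le_of_mul_le_mul_left (by linarith) hs
    have h2 := hpuniq x y (le_antisymm (le_norm_apply p _) h1)
    rcases Sym2.eq_iff.1 h2 with ⟨rfl, rfl⟩ | ⟨rfl, rfl⟩
    · rfl
    · exact Set.pair_comm _ _
  · refine lt_of_le_of_lt ((BoundedContinuousFunction.dist_le (C := 3 * (ε / 4))
      (by positivity)).2 fun q => ?_) (by linarith)
    rw [Real.dist_eq, hgapp, abs_le]
    have h1 : 0 ≤ κ * ρ q := mul_nonneg hκ.le (hρ.1 q.1 q.2)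
    have h2 : κ * ρ q ≤ ε / 4 := hκρ ▸ mul_le_mul_of_nonneg_left (le_norm_apply ρ q) hκ.le
    have h3 : 0 ≤ s * p q := mul_nonneg hs.le (hp.1 q.1 q.2)
    have h4 : s * p q ≤ ε / 4 := hsp ▸ mul_le_mul_of_nonneg_left (le_norm_apply p q) hs.le
    have h5 : d₁ q - ε / 4 ≤ min (d₁ q) c :=
      le_min (by linarith) (by linarith [le_norm_apply d₁ q])
    have h6 := min_le_left (d₁ q) c
    rw [hd₁app] at h5 h6 ⊢
    constructor <;> linarith

end Density

end MetricSpaces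

theorem mainTheorem1 {X : Type*} {Y : Type*} [TopologicalSpace X] [MetrizableSpace X]
    [TopologicalSpace Y] [MetrizableSpace Y] (hXY : IsEmpty X ↔ IsEmpty Y)
    (k : MetricSpaces.PeakKind) :
    List.TFAE [
      Nonempty (X ≃ₜ Y),
      ∃ T : MetricSpaces.pseudo X ≃ᵢ MetricSpaces.pseudo Y,
        MetricSpaces.CarriesOnto T (MetricSpaces.metr k X) (MetricSpaces.metr k Y),
      ∃ T : MetricSpaces.adm X ≃ᵢ MetricSpaces.adm Y,
        MetricSpaces.CarriesOnto T (MetricSpaces.metr k X) (MetricSpaces.metr k Y),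
      Nonempty (MetricSpaces.metr k X ≃ᵢ MetricSpaces.metr k Y)] ∧
    ∀ T : MetricSpaces.pseudo X ≃ᵢ MetricSpaces.pseudo Y,
      MetricSpaces.CarriesOnto T (MetricSpaces.metr k X) (MetricSpaces.metr k Y) →
      (∃ φ : Y ≃ₜ X, ∀ (d : MetricSpaces.pseudo X) (x y : Y),
        (T d).1 (x, y) = d.1 (φ x, φ y)) ∧
      (Nat.card X ≠ 2 → Nat.card Y ≠ 2 →
        ∃! φ : Y ≃ₜ X, ∀ (d : MetricSpaces.pseudo X) (x y : Y),
          (T d).1 (x, y) = d.1 (φ x, φ y)) := by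
  open MetricSpaces in
  refine ⟨?_, fun T _ => ?_⟩
  · tfae_have 1 → 2 := fun ⟨h⟩ => exists_isometryEquiv_pullback h.symm
      (fun _ => pullback_mem_pseudo _) (fun _ => pullback_mem_pseudo _)
      (fun _ => pullback_mem_metr k _) (fun _ => pullback_mem_metr k _)
      ((metr_subset_adm k).trans adm_subset_pseudo)
    tfae_have 1 → 3 := fun ⟨h⟩ => exists_isometryEquiv_pullback h.symm
      (fun _ => pullback_mem_adm _) (fun _ => pullback_mem_adm _)
      (fun _ => pullback_mem_metr k _) (fun _ => pullback_mem_metr k _)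
      (metr_subset_adm k)
    tfae_have 2 → 4 := fun ⟨T, hT⟩ => nonempty_isometryEquiv_of_carriesOnto
      ((metr_subset_adm k).trans adm_subset_pseudo)
      ((metr_subset_adm k).trans adm_subset_pseudo) T hT
    tfae_have 3 → 4 := fun ⟨T, hT⟩ => nonempty_isometryEquiv_of_carriesOnto
      (metr_subset_adm k) (metr_subset_adm k) T hT
    tfae_have 4 → 1 := by
      rintro ⟨T⟩
      rcases isEmpty_or_nonempty X with hX | hX
      · have hY := hXY.1 hX
        exact ⟨Homeomorph.empty⟩
      have hY : Nonempty Y := by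
        rw [← not_isEmpty_iff, ← hXY, not_isEmpty_iff]
        exact hX
      obtain ⟨S⟩ := nonempty_isometryEquiv_of_dense
        ((metr_subset_adm k).trans adm_subset_pseudo) isComplete_pseudo
        (pseudo_subset_closure_Pp.trans (closure_mono (Pp_subset_metr k)))
        ((metr_subset_adm k).trans adm_subset_pseudo) isComplete_pseudo
        (pseudo_subset_closure_Pp.trans (closure_mono (Pp_subset_metr k))) T
      obtain ⟨φ, -⟩ := exists_homeomorph_of_isometry hXY S
      exact ⟨φ.symm⟩
    tfae_finish
  · obtain ⟨φ, hφ⟩ := exists_homeomorph_of_isometry hXY T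
    refine ⟨⟨φ, hφ⟩, fun _ hY => ⟨φ, hφ, fun ψ hψ => ?_⟩⟩
    exact homeomorph_eq_of_forall_pseudo hY fun d hd x y =>
      (hψ ⟨d, hd⟩ x y).symm.trans (hφ ⟨d, hd⟩ x y)
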